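/- **Theorem (Heisenberg uncertainty inequality for the WVD-QOLCT).** Let $\mathbb H$ be the quaternions with modulus $|\cdot|_Q$ and let $\lambda,\mu\in\mathbb H$ satisfy $\lambda^2=\mu^2=-1$. For $\nu\in\{\lambda,\mu\}$ and $\theta\in\mathbb R$ put $e^{\nu\theta}=\cos\theta+\nu\sin\theta$. For $l=1,2$ let $a_l,b_l,c_l,d_l,\tau_l,\eta_l\in\mathbb R$ with $a_ld_l-b_lc_l=1$, and write $A_l$ for these six parameters. If $b_l\neq 0$, let $$K^{\nu}_{A_l}(x,y)=\frac{1}{\sqrt{\nu 2\pi b_l}}\,\exp\Big(\nu\,\frac{a_lx^2-2x(y-\tau_l)-2y(d_l\tau_l-b_l\eta_l)+d_l(y^2+\tau_l^2)}{2b_l}\Big),\qquad \frac1{\sqrt{\nu 2\pi b_l}}=\frac{e^{-\nu\,\mathrm{sgn}(b_l)\pi/4}}{\sqrt{2\pi|b_l|}} .$$ If $b_l=0$, let $D^{\nu}_{A_l}(y)=\sqrt{d_l}\;e^{\nu\left(\frac{c_ld_l}{2}(y-\tau_l)^2+y\tau_l\right)}$, where $\sqrt{d_l}=\nu\sqrt{-d_l}$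 if $d_l<0$. The two-sided quaternionic offset linear canonical transform (QOLCT) of $h:\mathbb R^2\to\mathbb H$ at $u\in\mathbb R^2$ is $$\mathcal O\{h\}(u)=\begin{cases}\displaystyle\int_{\mathbb R^2}K^\lambda_{A_1}(s_1,u_1)\,h(s)\,K^\mu_{A_2}(s_2,u_2)\,ds, & b_1,b_2\ne0,\\[1ex] \displaystyle\int_{\mathbb R}D^\lambda_{A_1}(u_1)\,h(d_1(u_1-\tau_1),s_2)\,K^\mu_{A_2}(s_2,u_2)\,ds_2, & b_1=0,\ b_2\neq0,\\[1ex] \displaystyle\int_{\mathbb R}K^\lambda_{A_1}(s_1,u_1)\,h(s_1,d_2(u_2-\tau_2))\,D^\mu_{A_2}(u_2)\,ds_1, & b_1\ne0,\ b_2=0,\\[1ex] D^\lambda_{A_1}(u_1)\,h(d_1(u_1-\tau_1),d_2(u_2-\tau_2))\,D^\mu_{A_2}(u_2), & b_1=b_2=0.\end{cases}$$ For a signal $h=h_0+ih_1+jh_2+kh_3$ with real-valued components $h_m$, put $$\|\mathcal O\{h\}(u)\|_Q=\Big(\sum_{m=0}^{3}|\mathcal O\{h_m\}(u)|_Q^2\Big)^{1/2}.$$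 For $f,g:\mathbb R^2\to\mathbb H$ and $t,s\in\mathbb R^2$ put $h_{f,g}(t,s)=f(t+\tfrac s2)\,\overline{g(t-\tfrac s2)}$. The Wigner-Ville distribution of $f,g$ associated with the QOLCT (WVD-QOLCT) is $\mathcal W_{f,g}(t,\xi)=\mathcal O\{h_{f,g}(t,\cdot)\}(\xi)$, and accordingly $$\Big\|\frac{\xi_k}{2\pi b_k}\mathcal W_{f,g}(t,\xi)\Big\|_Q=\Big|\frac{\xi_k}{2\pi b_k}\Big|\,\big\|\mathcal O\{h_{f,g}(t,\cdot)\}(\xi)\big\|_Q .$$ Finally, $|f|_{2,Q}=\big(\int_{\mathbb R^2}|f(t)|_Q^2\,dt\big)^{1/2}$. Then for all quaternion-valued Schwartz functions $f,g\in\mathcal S(\mathbb R^2,\mathbb H)$ and each $k\in\{1,2\}$ with $b_k\neq0$, $$\left(\int_{\mathbb R^2}\int_{\mathbb R^2}\big|s_k\,f(t+\tfrac s2)\,\overline{g(t-\tfrac s2)}\big|_Q^2\,ds\,dt\right)\left(\int_{\mathbb R^2}\int_{\mathbb R^2}\Big\|\frac{\xi_k}{2\pi b_k}\mathcal W_{f,g}(t,\xi)\Big\|_Q^2\,d\xi\,dt\right)\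 \ge\ \frac{1}{16\pi^2}\,|f|_{2,Q}^4\,|g|_{2,Q}^4 .$$ -/

import Mathlib

open MeasureTheory
open scoped Quaternion SchwartzMap

namespace QOLCT

noncomputable section

/-- The real parameters `(a, b, c, d | τ, η)` of a one-dimensional offset linear canonical
transform, with `a d - b c = 1`. -/
structure Params where
  a : ℝ
  b : ℝ
  c : ℝ
  d : ℝ
  τ : ℝ
  η : ℝ
  det_eq_one : a * d - b * c = 1

/-- `ℝ²` with its Euclidean norm and Lebesgue measure. -/
abbrev Plane : Type := EuclideanSpace ℝ (Fin 2)

/-- `e^{ν θ} = cos θ + ν sin θ` for a pure unit quaternion `ν` and a real `θ`. -/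
def unitExp (ν : ℍ[ℝ]) (θ : ℝ) : ℍ[ℝ] :=
  (Real.cos θ : ℍ[ℝ]) + ν * (Real.sin θ : ℍ[ℝ])

/-- The principal value of `1 / √(ν 2 π b)` for real `b ≠ 0`, with
`1 / √ν = e^{-ν π / 4}` and `1 / √(-ν) = e^{ν π / 4}`. -/
def kernelConst (ν : ℍ[ℝ]) (b : ℝ) : ℍ[ℝ] :=
  ((1 / Real.sqrt (2 * Real.pi * |b|) : ℝ) : ℍ[ℝ]) *
    unitExp ν (-(SignType.sign b : ℝ) * (Real.pi / 4))

/-- The kernel `K^ν_A(t, u)`, used when `A.b ≠ 0`. -/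
def kernel (ν : ℍ[ℝ]) (A : Params) (t u : ℝ) : ℍ[ℝ] :=
  kernelConst ν A.b *
    unitExp ν ((A.a * t ^ 2 - 2 * t * (u - A.τ) - 2 * u * (A.d * A.τ - A.b * A.η)
      + A.d * (u ^ 2 + A.τ ^ 2)) * (1 / (2 * A.b)))

/-- The principal square root of the real number `x`, in the complex plane `ℝ + ℝ ν`. -/
def principalSqrt (ν : ℍ[ℝ]) (x : ℝ) : ℍ[ℝ] :=
  if 0 ≤ x then (Real.sqrt x : ℍ[ℝ]) else ν * (Real.sqrt (-x) : ℍ[ℝ])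

/-- The factor `√d e^{ν (c d (u - τ)² / 2 + u τ)}`, which stands in for the kernel when
`A.b = 0`. -/
def degenerateFactor (ν : ℍ[ℝ]) (A : Params) (u : ℝ) : ℍ[ℝ] :=
  principalSqrt ν A.d * unitExp ν (A.c * A.d / 2 * (u - A.τ) ^ 2 + u * A.τ)

/-- The two-sided quaternionic offset linear canonical transform of `h : ℝ² → ℍ` at `u`. In a
variable whose parameter `b` is zero, the integration against the kernel is replaced by evaluation
at `d (u - τ)`. -/
def qolct (lam mu : ℍ[ℝ]) (A : Fin 2 → Params) (h : Plane → ℍ[ℝ]) (u : Plane) : ℍ[ℝ] :=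
  if (A 0).b ≠ 0 then
    if (A 1).b ≠ 0 then
      ∫ s : Plane, kernel lam (A 0) (s 0) (u 0) * h s * kernel mu (A 1) (s 1) (u 1)
    else
      ∫ x : ℝ, kernel lam (A 0) x (u 0) * h !₂[x, (A 1).d * (u 1 - (A 1).τ)]
        * degenerateFactor mu (A 1) (u 1)
  else
    if (A 1).b ≠ 0 then
      ∫ y : ℝ, degenerateFactor lam (A 0) (u 0) * h !₂[(A 0).d * (u 0 - (A 0).τ), y]
        * kernel mu (A 1) y (u 1)
    else
      degenerateFactor lam (A 0) (u 0)
        * h !₂[(A 0).d * (u 0 - (A 0).τ), (A 1).d * (u 1 - (A 1).τ)]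
        * degenerateFactor mu (A 1) (u 1)

/-- The real components `q₀, q₁, q₂, q₃` of `q = q₀ + i q₁ + j q₂ + k q₃`. -/
def component (m : Fin 4) (q : ℍ[ℝ]) : ℝ :=
  ![q.re, q.imI, q.imJ, q.imK] m

/-- For a transform `T` of quaternion-valued signals, the modulus
`‖T{h}(u)‖_Q = √(∑ₘ |T{hₘ}(u)|²)`, where `h = h₀ + i h₁ + j h₂ + k h₃` with real-valued `hₘ`. -/
def transformModulus (T : (Plane → ℍ[ℝ]) → Plane → ℍ[ℝ]) (h : Plane → ℍ[ℝ]) (u : Plane) : ℝ :=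
  Real.sqrt (∑ m : Fin 4, ‖T (fun s => ((component m (h s) : ℝ) : ℍ[ℝ])) u‖ ^ 2)

/-- `h_{f,g}(t, s) = f(t + s/2) \bar g(t - s/2)`. -/
def crossSignal (f g : Plane → ℍ[ℝ]) (t s : Plane) : ℍ[ℝ] :=
  f (t + (1 / 2 : ℝ) • s) * star (g (t - (1 / 2 : ℝ) • s))

/-- The Wigner-Ville distribution `W_{f,g}(t, u)` associated with the two-sided QOLCT: the QOLCT of
`s ↦ f(t + s/2) \bar g(t - s/2)`, evaluated at `u`. -/
def wvd (lam mu : ℍ[ℝ]) (A : Fin 2 → Params) (f g : Plane → ℍ[ℝ]) (t u : Plane) : ℍ[ℝ] :=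
  qolct lam mu A (crossSignal f g t) u

/-- `‖W_{f,g}(t, u)‖_Q`, the modulus of the QOLCT `W_{f,g}(t, ·)` of `h_{f,g}(t, ·)` at `u`. As for
every transform, the modulus `‖·‖_Q` is taken through the real components of the transformed
signal, so it is not the quaternion modulus of the value `wvd lam mu A f g t u`. -/
def wvdModulus (lam mu : ℍ[ℝ]) (A : Fin 2 → Params) (f g : Plane → ℍ[ℝ]) (t u : Plane) : ℝ :=
  transformModulus (qolct lam mu A) (crossSignal f g t) u

/-- `|f|_{2,Q} = (∫ |f(t)|² dt)^{1/2}`. -/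
def l2Norm (f : Plane → ℍ[ℝ]) : ℝ :=
  Real.sqrt (∫ t : Plane, ‖f t‖ ^ 2)

end

end QOLCT

/-! Up to a constant phase and scaling, the transform of a real signal `φ` is a Fourier transform of
`φ` times a chirp `e^{iQ}`, at frequency `ξ_k / (2π b_k)`. The weight in the theorem is therefore a
derivative. For real `φ`, `e^{-iQ} ∂(e^{iQ} φ) = ∂φ + i (∂Q) φ` splits into real and imaginary
parts, so by Plancherel the weighted energy is `1/(4π²) ∫ (∂_k φ)² + (r φ)²` with `r = (a s_k +
τ)/b`.

The two-sided quaternionic kernel reduces to this complex picture: `e^{λα} φ e^{μβ}` is a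
real-linear image of `e^{i(α+β)} φ` and `e^{i(α-β)} φ`, and the squared moduli of these add with
weights `(1 ± ⟨λ,μ⟩)/2` (`norm_phasesToQuaternion_sq`). Both phases give the same energy and the
weights sum to 1, so `λ` and `μ` disappear (`integrable_and_integral_norm_qolct_sq`). If the other
`b` vanishes, a one-dimensional Plancherel on slices gives the same value. Summing over components
yields `integral_transformModulus_sq`.

What remains is the classical argument for `h = h_{f,g}(t, ·)`: `∫ ‖s_k h + x ∂_k h‖² ≥ 0` for all
real `x`, with integration by parts (`quadratic_heisenberg`). Dropping or adding the chirp energy is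
harmless. The quadratic is integrated over `t`, where `∬ ‖h‖² = |f|² |g|²`, and its discriminant is
the theorem. -/

namespace QOLCT

open scoped FourierTransform LineDeriv RealInnerProductSpace

/-! ### Real signals multiplied by a chirp -/

section Chirp

/-- Every derivative is a power of `i` times the function, hence of modulus 1: degree 0 and constant
1 suffice. -/
theorem hasTemperateGrowth_cexp_ofReal_mul_I :
    (fun x : ℝ => Complex.exp (x * Complex.I)).HasTemperateGrowth := by
  have hd : ∀ n : ℕ, iteratedDeriv n (fun x : ℝ => Complex.exp (x * Complex.I))
      = fun x : ℝ => Complex.I ^ n * Complex.exp (x * Complex.I) := by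
    intro n
    induction n with
    | zero => simp
    | succ n ih =>
      rw [iteratedDeriv_succ, ih]
      funext x
      have h1 : HasDerivAt (fun x : ℝ => (x : ℂ) * Complex.I) Complex.I x := by
        simpa using (Complex.ofRealCLM.hasDerivAt (x := x)).mul_const Complex.I
      have h2 := (h1.cexp).const_mul (Complex.I ^ n)
      rw [h2.deriv]
      ring
  refine ⟨?_, fun n => ⟨0, 1, fun x => ?_⟩⟩
  · exact (Complex.ofRealCLM.contDiff.mul contDiff_const).cexp
  · rw [norm_iteratedFDeriv_eq_norm_iteratedDeriv, hd]
    simp [Complex.norm_exp]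

variable {V : Type*} [NormedAddCommGroup V] [NormedSpace ℝ V]

/-- The product `e^{i Q} φ` of a real-valued Schwartz function with a chirp. -/
noncomputable def chirp (Q : V → ℝ) (φ : 𝓢(V, ℝ)) : 𝓢(V, ℂ) :=
  SchwartzMap.smulLeftCLM ℂ (fun x => Complex.exp (Q x * Complex.I))
    (SchwartzMap.postcompCLM (𝕜 := ℝ) Complex.ofRealCLM φ)

theorem chirp_apply {Q : V → ℝ} (hQ : Q.HasTemperateGrowth) (φ : 𝓢(V, ℝ)) (x : V) :
    chirp Q φ x = Complex.exp (Q x * Complex.I) * φ x := by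
  have h : (fun x => Complex.exp (Q x * Complex.I)).HasTemperateGrowth :=
    hasTemperateGrowth_cexp_ofReal_mul_I.comp hQ
  simp [chirp, h]

/-- There is no cross term because `φ` is real: after removal of the unimodular factor, the two
summands of the product rule are the real and imaginary parts. -/
theorem norm_lineDerivOp_chirp_sq {Q : V → ℝ} (hQ : Q.HasTemperateGrowth) (φ : 𝓢(V, ℝ)) (v x : V) :
    ‖∂_{v} (chirp Q φ) x‖ ^ 2 = (∂_{v} φ x) ^ 2 + (fderiv ℝ Q x v * φ x) ^ 2 := by
  have hQd : HasFDerivAt Q (fderiv ℝ Q x) x :=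
    ((hQ.1.differentiable (by simp)) x).hasFDerivAt
  have h1 : HasFDerivAt (fun x => (Q x : ℂ)) (Complex.ofRealCLM.comp (fderiv ℝ Q x)) x :=
    Complex.ofRealCLM.hasFDerivAt.comp x hQd
  have h2 : HasFDerivAt (fun x => (φ x : ℂ)) (Complex.ofRealCLM.comp (fderiv ℝ φ x)) x :=
    Complex.ofRealCLM.hasFDerivAt.comp x (φ.hasFDerivAt x)
  have h3 := ((h1.mul_const Complex.I).cexp).mul h2
  have h4 : (chirp Q φ : V → ℂ) = fun x => Complex.exp (Q x * Complex.I) * φ x :=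
    funext (chirp_apply hQ φ)
  rw [SchwartzMap.lineDerivOp_apply_eq_fderiv, SchwartzMap.lineDerivOp_apply_eq_fderiv, h4]
  have h5 : fderiv ℝ (fun x => Complex.exp (Q x * Complex.I) * φ x) x v = Complex.exp
      (Q x * Complex.I) * ((fderiv ℝ φ x v : ℝ) + (fderiv ℝ Q x v * φ x : ℝ) * Complex.I) := by
    erw [h3.fderiv]
    simp
    ring
  rw [h5, norm_mul, Complex.norm_exp_ofReal_mul_I, one_mul, Complex.sq_norm,
    Complex.normSq_add_mul_I]

end Chirp

/-! ### Plancherel for derivatives of chirped signals -/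

section Fourier

variable {V : Type*} [NormedAddCommGroup V] [InnerProductSpace ℝ V] [FiniteDimensional ℝ V]
  [MeasurableSpace V] [BorelSpace V]

theorem integrable_norm_sq {D F : Type*} [NormedAddCommGroup D] [NormedSpace ℝ D]
    [FiniteDimensional ℝ D] [MeasurableSpace D] [BorelSpace D] [NormedAddCommGroup F]
    [NormedSpace ℝ F] (μ : Measure D) [μ.IsAddHaarMeasure] (φ : 𝓢(D, F)) :
    Integrable (fun x => ‖φ x‖ ^ 2) μ :=
  (φ.memLp 2 μ).integrable_norm_pow (by norm_num)

theorem norm_fourier_lineDerivOp_sq (ψ : 𝓢(V, ℂ)) (v w : V) :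
    ‖𝓕 (∂_{v} ψ) w‖ ^ 2 = 4 * Real.pi ^ 2 * (⟪w, v⟫ ^ 2 * ‖𝓕 (ψ : V → ℂ) w‖ ^ 2) := by
  have h : (inner ℝ · v).HasTemperateGrowth := ((innerSL ℝ).flip v).hasTemperateGrowth
  rw [SchwartzMap.fourier_lineDerivOp_eq]
  simp only [smul_apply, SchwartzMap.smulLeftCLM_apply_apply h, SchwartzMap.fourier_coe]
  rw [norm_smul, norm_smul]
  simp only [norm_mul, Complex.norm_ofNat, Complex.norm_real, Complex.norm_I, Real.norm_eq_abs,
    mul_pow, sq_abs]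
  ring

theorem integrable_inner_sq_mul_norm_fourier_sq (ψ : 𝓢(V, ℂ)) (v : V) :
    Integrable (fun w => ⟪w, v⟫ ^ 2 * ‖𝓕 (ψ : V → ℂ) w‖ ^ 2) := by
  have h := (integrable_norm_sq volume (𝓕 (∂_{v} ψ))).const_mul (1 / (4 * Real.pi ^ 2))
  refine h.congr (Filter.Eventually.of_forall fun w => ?_)
  have := Real.pi_pos
  simp only [norm_fourier_lineDerivOp_sq]
  field_simp

theorem integral_inner_sq_mul_norm_fourier_sq (ψ : 𝓢(V, ℂ)) (v : V) :
    ∫ w, ⟪w, v⟫ ^ 2 * ‖𝓕 (ψ : V → ℂ) w‖ ^ 2 = 1 / (4 * Real.pi ^ 2) * ∫ x, ‖∂_{v} ψ x‖ ^ 2 := by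
  have := Real.pi_pos
  rw [← SchwartzMap.integral_norm_sq_fourier]
  simp only [norm_fourier_lineDerivOp_sq]
  rw [integral_const_mul]
  field_simp

theorem integral_inner_sq_mul_norm_fourier_chirp_sq {Q : V → ℝ} (hQ : Q.HasTemperateGrowth)
    (φ : 𝓢(V, ℝ)) (v : V) :
    ∫ w, ⟪w, v⟫ ^ 2 * ‖𝓕 (chirp Q φ : V → ℂ) w‖ ^ 2
      = 1 / (4 * Real.pi ^ 2) * ∫ x, ((∂_{v} φ x) ^ 2 + (fderiv ℝ Q x v * φ x) ^ 2) := by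
  rw [integral_inner_sq_mul_norm_fourier_sq]
  simp only [norm_lineDerivOp_chirp_sq hQ]

theorem norm_integral_phase_eq_norm_fourier_chirp {Q : V → ℝ} (hQ : Q.HasTemperateGrowth)
    (φ : 𝓢(V, ℝ)) (w : V) (θ : V → ℝ) (c : ℝ) (hθ : ∀ x, θ x = Q x - 2 * Real.pi * ⟪x, w⟫ + c) :
    ‖∫ x, Complex.exp (θ x * Complex.I) * φ x‖ = ‖𝓕 (chirp Q φ : V → ℂ) w‖ := by
  have h : ∀ x, Complex.exp (θ x * Complex.I) * φ x = Complex.exp (c * Complex.I) *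
      (Complex.exp (↑(-2 * Real.pi * ⟪x, w⟫) * Complex.I) • chirp Q φ x) := by
    intro x
    rw [chirp_apply hQ, hθ, smul_eq_mul, ← mul_assoc, ← mul_assoc, ← Complex.exp_add,
      ← Complex.exp_add]
    congr 2
    push_cast
    ring
  simp_rw [h]
  rw [integral_const_mul, norm_mul, Complex.norm_exp_ofReal_mul_I, one_mul, Real.fourier_eq']

end Fourier

/-! ### Reduction of quaternionic integrals to complex ones -/

section Quaternion

theorem norm_sq_eq (q : ℍ[ℝ]) : ‖q‖ ^ 2 = q.re ^ 2 + q.imI ^ 2 + q.imJ ^ 2 + q.imK ^ 2 := by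
  rw [sq, ← Quaternion.normSq_eq_norm_mul_self, Quaternion.normSq_def']

theorem re_eq_zero_of_sq_eq_neg_one {ν : ℍ[ℝ]} (h : ν ^ 2 = -1) : ν.re = 0 := by
  have h0 := congrArg QuaternionAlgebra.re h
  have h1 := congrArg QuaternionAlgebra.imI h
  have h2 := congrArg QuaternionAlgebra.imJ h
  have h3 := congrArg QuaternionAlgebra.imK h
  simp [sq] at h0 h1 h2 h3
  by_contra hr
  have e1 : ν.imI = 0 := mul_left_cancel₀ hr (by linarith)
  have e2 : ν.imJ = 0 := mul_left_cancel₀ hr (by linarith)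
  have e3 : ν.imK = 0 := mul_left_cancel₀ hr (by linarith)
  rw [e1, e2, e3] at h0
  nlinarith [mul_self_nonneg ν.re]

theorem im_sq_sum_of_sq_eq_neg_one {ν : ℍ[ℝ]} (h : ν ^ 2 = -1) :
    ν.imI ^ 2 + ν.imJ ^ 2 + ν.imK ^ 2 = 1 := by
  have h0 := congrArg QuaternionAlgebra.re h
  simp [sq, re_eq_zero_of_sq_eq_neg_one h] at h0
  linarith

theorem norm_eq_one_of_sq_eq_neg_one {ν : ℍ[ℝ]} (h : ν ^ 2 = -1) : ‖ν‖ = 1 := by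
  have h1 : ‖ν‖ ^ 2 = 1 := by
    rw [norm_sq_eq, re_eq_zero_of_sq_eq_neg_one h]
    linarith [im_sq_sum_of_sq_eq_neg_one h]
  nlinarith [norm_nonneg ν]

theorem unitExp_add {ν : ℍ[ℝ]} (h : ν ^ 2 = -1) (x y : ℝ) :
    unitExp ν (x + y) = unitExp ν x * unitExp ν y := by
  have h0 := re_eq_zero_of_sq_eq_neg_one h
  have h1 := im_sq_sum_of_sq_eq_neg_one h
  ext
  · simp [unitExp, Real.cos_add, Real.sin_add, h0]
    linear_combination (Real.sin x * Real.sin y) * h1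
  all_goals
    simp [unitExp, Real.cos_add, Real.sin_add, h0]
    ring

theorem norm_unitExp {ν : ℍ[ℝ]} (h : ν ^ 2 = -1) (x : ℝ) : ‖unitExp ν x‖ = 1 := by
  have h1 : ‖unitExp ν x‖ ^ 2 = 1 := by
    rw [norm_sq_eq]
    simp [unitExp, re_eq_zero_of_sq_eq_neg_one h]
    linear_combination (Real.sin x) ^ 2 * im_sq_sum_of_sq_eq_neg_one h + Real.sin_sq_add_cos_sq x
  nlinarith [norm_nonneg (unitExp ν x)]

theorem norm_principalSqrt_sq {ν : ℍ[ℝ]} (h : ν ^ 2 = -1) (x : ℝ) :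
    ‖principalSqrt ν x‖ ^ 2 = |x| := by
  unfold principalSqrt
  split_ifs with hx
  · rw [Quaternion.norm_coe, Real.norm_eq_abs, sq_abs, Real.sq_sqrt hx, abs_of_nonneg hx]
  · rw [norm_mul, norm_eq_one_of_sq_eq_neg_one h, one_mul, Quaternion.norm_coe, Real.norm_eq_abs,
      sq_abs, Real.sq_sqrt (by linarith), abs_of_neg (by linarith)]

theorem norm_degenerateFactor_sq {ν : ℍ[ℝ]} (h : ν ^ 2 = -1) (A : Params) (u : ℝ) :
    ‖degenerateFactor ν A u‖ ^ 2 = |A.d| := by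
  rw [degenerateFactor, norm_mul, norm_unitExp h, mul_one, norm_principalSqrt_sq h]

/-- The phase of the kernel `kernel ν A`. -/
noncomputable def kernelPhase (A : Params) (t u : ℝ) : ℝ :=
  -(SignType.sign A.b : ℝ) * (Real.pi / 4) +
    (A.a * t ^ 2 - 2 * t * (u - A.τ) - 2 * u * (A.d * A.τ - A.b * A.η)
      + A.d * (u ^ 2 + A.τ ^ 2)) * (1 / (2 * A.b))

theorem kernel_eq {ν : ℍ[ℝ]} (h : ν ^ 2 = -1) (A : Params) (t u : ℝ) :
    kernel ν A t u = ((1 / Real.sqrt (2 * Real.pi * |A.b|) : ℝ) : ℍ[ℝ]) *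
      unitExp ν (kernelPhase A t u) := by
  rw [kernel, kernelConst, kernelPhase, unitExp_add h, mul_assoc]

theorem one_div_sqrt_sq (b : ℝ) :
    (1 / Real.sqrt (2 * Real.pi * |b|)) ^ 2 = 1 / (2 * Real.pi * |b|) := by
  rw [div_pow, Real.sq_sqrt (by positivity), one_pow]

/-- The real-linear map `x + i y ↦ x + ν y`. -/
noncomputable def complexToQuaternion (ν : ℍ[ℝ]) : ℂ →L[ℝ] ℍ[ℝ] :=
  Complex.reCLM.smulRight (1 : ℍ[ℝ]) + Complex.imCLM.smulRight ν

theorem complexToQuaternion_apply (ν : ℍ[ℝ]) (z : ℂ) :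
    complexToQuaternion ν z = z.re • (1 : ℍ[ℝ]) + z.im • ν := rfl

theorem norm_complexToQuaternion {ν : ℍ[ℝ]} (h : ν ^ 2 = -1) (z : ℂ) :
    ‖complexToQuaternion ν z‖ = ‖z‖ := by
  have h1 : ‖complexToQuaternion ν z‖ ^ 2 = ‖z‖ ^ 2 := by
    rw [norm_sq_eq, Complex.sq_norm, Complex.normSq_apply]
    simp [complexToQuaternion_apply, re_eq_zero_of_sq_eq_neg_one h]
    linear_combination z.im ^ 2 * im_sq_sum_of_sq_eq_neg_one h
  exact (sq_eq_sq₀ (norm_nonneg _) (norm_nonneg _)).1 h1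

theorem complexToQuaternion_exp_mul (ν : ℍ[ℝ]) (θ r : ℝ) :
    complexToQuaternion ν (Complex.exp (θ * Complex.I) * r) = unitExp ν θ * (r : ℍ[ℝ]) := by
  rw [complexToQuaternion_apply, Complex.re_mul_ofReal, Complex.im_mul_ofReal,
    Complex.exp_ofReal_mul_I_re, Complex.exp_ofReal_mul_I_im]
  ext <;> simp [unitExp] <;> ring

/-- The real-linear map sending `(e^{i (α + β)}, e^{i (α - β)})` to `e^{λ α} e^{μ β}`. -/
noncomputable def phasesToQuaternion (lam mu : ℍ[ℝ]) : ℂ × ℂ →L[ℝ] ℍ[ℝ] :=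
  LinearMap.toContinuousLinearMap
    { toFun := fun p => (2⁻¹ : ℝ) • ((p.1.re + p.2.re) • (1 : ℍ[ℝ]) + (p.1.im + p.2.im) • lam
        + (p.1.im - p.2.im) • mu + (p.2.re - p.1.re) • (lam * mu))
      map_add' := fun p q => by
        simp only [Prod.fst_add, Prod.snd_add, Complex.add_re, Complex.add_im]
        module
      map_smul' := fun c p => by
        simp only [Prod.smul_fst, Prod.smul_snd, Complex.real_smul, Complex.mul_re, Complex.mul_im,
          Complex.ofReal_re, Complex.ofReal_im, RingHom.id_apply]
        module }

theorem phasesToQuaternion_apply (lam mu : ℍ[ℝ]) (p : ℂ × ℂ) :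
    phasesToQuaternion lam mu p = (2⁻¹ : ℝ) • ((p.1.re + p.2.re) • (1 : ℍ[ℝ])
      + (p.1.im + p.2.im) • lam + (p.1.im - p.2.im) • mu + (p.2.re - p.1.re) • (lam * mu)) := rfl

/-- The real inner product of two pure quaternions. -/
def imInner (p q : ℍ[ℝ]) : ℝ := p.imI * q.imI + p.imJ * q.imJ + p.imK * q.imK

/-- The map has coefficients `1 - λμ`, `λ + μ` on the first entry and `1 + λμ`, `λ - μ` on the
second, each halved. These four quaternions are pairwise orthogonal, with squared norms `2 + 2⟨λ,μ⟩`
(the first two) and `2 - 2⟨λ,μ⟩` (the last two). -/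
theorem norm_phasesToQuaternion_sq {lam mu : ℍ[ℝ]} (hlam : lam ^ 2 = -1) (hmu : mu ^ 2 = -1)
    (p : ℂ × ℂ) : ‖phasesToQuaternion lam mu p‖ ^ 2 =
      (1 + imInner lam mu) / 2 * ‖p.1‖ ^ 2 + (1 - imInner lam mu) / 2 * ‖p.2‖ ^ 2 := by
  have h0 := re_eq_zero_of_sq_eq_neg_one hlam
  have h1 := im_sq_sum_of_sq_eq_neg_one hlam
  have k0 := re_eq_zero_of_sq_eq_neg_one hmu
  have k1 := im_sq_sum_of_sq_eq_neg_one hmu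
  rw [norm_sq_eq, Complex.sq_norm, Complex.sq_norm, Complex.normSq_apply, Complex.normSq_apply]
  simp [phasesToQuaternion_apply, h0, k0, imInner]
  generalize p.1.re = a, p.1.im = b, p.2.re = c, p.2.im = d
  generalize lam.imI = x, lam.imJ = y, lam.imK = z at *
  generalize mu.imI = u, mu.imJ = v, mu.imK = w at *
  -- The last coefficient encodes `|λμ|² = |λ|² |μ|² = 1`.
  linear_combination (1/4) * (b + d) ^ 2 * h1 + (1/4) * (b - d) ^ 2 * k1
    + (1/4) * (c - a) ^ 2 * ((u ^ 2 + v ^ 2 + w ^ 2) * h1 + k1)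

theorem phasesToQuaternion_exp_mul (lam mu : ℍ[ℝ]) (α β r : ℝ) :
    phasesToQuaternion lam mu (Complex.exp (↑(α + β) * Complex.I) * r,
      Complex.exp (↑(α - β) * Complex.I) * r) = unitExp lam α * (r : ℍ[ℝ]) * unitExp mu β := by
  rw [phasesToQuaternion_apply]
  simp only [Complex.re_mul_ofReal, Complex.im_mul_ofReal, Complex.exp_ofReal_mul_I_re,
    Complex.exp_ofReal_mul_I_im, Real.cos_add, Real.sin_add, Real.cos_sub, Real.sin_sub]
  ext <;> simp [unitExp] <;> ring

variable {X : Type*} [MeasurableSpace X] {m : Measure X}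

theorem integrable_exp_mul {θ φ : X → ℝ} (hθ : Measurable θ) (hφ : Integrable φ m) :
    Integrable (fun x => Complex.exp (θ x * Complex.I) * φ x) m := by
  refine hφ.ofReal.bdd_mul (c := 1) (by fun_prop) (Filter.Eventually.of_forall fun x => ?_)
  rw [Complex.norm_exp_ofReal_mul_I]

theorem norm_integral_left_sq {lam : ℍ[ℝ]} (hlam : lam ^ 2 = -1) {θ φ : X → ℝ} (hθ : Measurable θ)
    (hφ : Integrable φ m) (κ : ℝ) (q : ℍ[ℝ]) :
    ‖∫ x, (κ : ℍ[ℝ]) * unitExp lam (θ x) * (φ x : ℍ[ℝ]) * q ∂m‖ ^ 2 =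
      κ ^ 2 * ‖q‖ ^ 2 * ‖∫ x, Complex.exp (θ x * Complex.I) * φ x ∂m‖ ^ 2 := by
  have h : ∀ x, (κ : ℍ[ℝ]) * unitExp lam (θ x) * (φ x : ℍ[ℝ]) * q
      = (κ : ℍ[ℝ]) * (complexToQuaternion lam (Complex.exp (θ x * Complex.I) * φ x) * q) := by
    intro x
    rw [complexToQuaternion_exp_mul]
    simp only [mul_assoc]
  simp_rw [h]
  have hi := (complexToQuaternion lam).integrable_comp (integrable_exp_mul hθ hφ)
  rw [integral_const_mul_of_integrable (hi.mul_const q), integral_mul_const_of_integrable hi,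
    ContinuousLinearMap.integral_comp_comm _ (integrable_exp_mul hθ hφ), norm_mul, norm_mul,
    norm_complexToQuaternion hlam, Quaternion.norm_coe, Real.norm_eq_abs, mul_pow, mul_pow, sq_abs]
  ring

theorem norm_integral_right_sq {mu : ℍ[ℝ]} (hmu : mu ^ 2 = -1) {θ φ : X → ℝ} (hθ : Measurable θ)
    (hφ : Integrable φ m) (κ : ℝ) (q : ℍ[ℝ]) :
    ‖∫ x, q * (φ x : ℍ[ℝ]) * ((κ : ℍ[ℝ]) * unitExp mu (θ x)) ∂m‖ ^ 2 =
      κ ^ 2 * ‖q‖ ^ 2 * ‖∫ x, Complex.exp (θ x * Complex.I) * φ x ∂m‖ ^ 2 := by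
  have h : ∀ x, q * (φ x : ℍ[ℝ]) * ((κ : ℍ[ℝ]) * unitExp mu (θ x))
      = (κ : ℍ[ℝ]) * (q * complexToQuaternion mu (Complex.exp (θ x * Complex.I) * φ x)) := by
    intro x
    rw [complexToQuaternion_exp_mul]
    ext <;> simp <;> ring
  simp_rw [h]
  have hi := (complexToQuaternion mu).integrable_comp (integrable_exp_mul hθ hφ)
  rw [integral_const_mul_of_integrable (hi.const_mul q), integral_const_mul_of_integrable hi,
    ContinuousLinearMap.integral_comp_comm _ (integrable_exp_mul hθ hφ), norm_mul, norm_mul,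
    norm_complexToQuaternion hmu, Quaternion.norm_coe, Real.norm_eq_abs, mul_pow, mul_pow, sq_abs]
  ring

/-- Real values of `φ` are central, so the integrand is a fixed real-linear image of a pair of
complex integrands, and that map commutes with the integral. -/
theorem norm_integral_two_sided_sq {lam mu : ℍ[ℝ]} (hlam : lam ^ 2 = -1) (hmu : mu ^ 2 = -1)
    {α β φ : X → ℝ} (hα : Measurable α) (hβ : Measurable β) (hφ : Integrable φ m) (κ κ' : ℝ) :
    ‖∫ x, (κ : ℍ[ℝ]) * unitExp lam (α x) * (φ x : ℍ[ℝ]) * ((κ' : ℍ[ℝ]) * unitExp mu (β x)) ∂m‖ ^ 2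
      = κ ^ 2 * κ' ^ 2 *
        ((1 + imInner lam mu) / 2 * ‖∫ x, Complex.exp (↑(α x + β x) * Complex.I) * φ x ∂m‖ ^ 2
        + (1 - imInner lam mu) / 2 *
          ‖∫ x, Complex.exp (↑(α x - β x) * Complex.I) * φ x ∂m‖ ^ 2) := by
  have h : ∀ x, (κ : ℍ[ℝ]) * unitExp lam (α x) * (φ x : ℍ[ℝ]) * ((κ' : ℍ[ℝ]) * unitExp mu (β x))
      = (κ * κ') • phasesToQuaternion lam mu (Complex.exp (↑(α x + β x) * Complex.I) * φ x,
        Complex.exp (↑(α x - β x) * Complex.I) * φ x) := by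
    intro x
    rw [phasesToQuaternion_exp_mul]
    ext <;> simp <;> ring
  simp_rw [h]
  have h1 := integrable_exp_mul (hα.add hβ) hφ
  have h2 := integrable_exp_mul (hα.sub hβ) hφ
  simp only [Pi.add_apply, Pi.sub_apply] at h1 h2
  rw [integral_smul, ContinuousLinearMap.integral_comp_comm _ (h1.prodMk h2), norm_smul, mul_pow,
    norm_phasesToQuaternion_sq hlam hmu, integral_pair h1 h2, Real.norm_eq_abs, sq_abs, mul_pow]

end Quaternion

/-! ### Affine changes of variable in the plane -/

section ChangeOfVariables

theorem map_volume_affine {c : ℝ} (hc : c ≠ 0) (e : ℝ) :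
    Measure.map (fun x : ℝ => c * x + e) volume = ENNReal.ofReal |c⁻¹| • volume := by
  have h := Measure.map_map (μ := (volume : Measure ℝ)) (measurable_add_const e)
    (measurable_const_mul c)
  rw [Real.map_volume_mul_left hc, Measure.map_smul, map_add_right_eq_self] at h
  exact h.symm

theorem integrable_and_integral_comp_affine {G : ℝ × ℝ → ℝ} (hG : Integrable G) {c c' : ℝ}
    (hc : c ≠ 0) (hc' : c' ≠ 0) (e e' : ℝ) :
    Integrable (fun p : ℝ × ℝ => G (c * p.1 + e, c' * p.2 + e')) ∧
      |c| * |c'| * ∫ p : ℝ × ℝ, G (c * p.1 + e, c' * p.2 + e') = ∫ p, G p := by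
  have hmap : Measure.map (Prod.map (fun x : ℝ => c * x + e) (fun x : ℝ => c' * x + e'))
      (volume : Measure (ℝ × ℝ)) = (ENNReal.ofReal |c⁻¹| * ENNReal.ofReal |c'⁻¹|) • volume := by
    rw [Measure.volume_eq_prod, ← Measure.map_prod_map _ _ (by fun_prop) (by fun_prop),
      map_volume_affine hc, map_volume_affine hc', Measure.prod_smul_left, Measure.prod_smul_right,
      smul_smul]
  have hmeas : Measurable (Prod.map (fun x : ℝ => c * x + e) (fun x : ℝ => c' * x + e')) := by
    fun_prop
  have hG' : Integrable G (Measure.map (Prod.map (fun x : ℝ => c * x + e)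
      (fun x : ℝ => c' * x + e')) (volume : Measure (ℝ × ℝ))) := by
    rw [hmap]
    exact hG.smul_measure (ENNReal.mul_ne_top ENNReal.ofReal_ne_top ENNReal.ofReal_ne_top)
  refine ⟨hG'.comp_measurable hmeas, ?_⟩
  have h := integral_map hmeas.aemeasurable hG'.aestronglyMeasurable
  rw [hmap, integral_smul_measure, ENNReal.toReal_mul, ENNReal.toReal_ofReal (abs_nonneg _),
    ENNReal.toReal_ofReal (abs_nonneg _)] at h
  simp only [Prod.map] at h
  rw [← h, smul_eq_mul, abs_inv, abs_inv]
  have := abs_pos.2 hc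
  have := abs_pos.2 hc'
  field_simp

/-- The identification of `ℝ × ℝ` with the plane. -/
noncomputable def planeEquiv : (ℝ × ℝ) ≃L[ℝ] Plane :=
  ((EuclideanSpace.equiv (Fin 2) ℝ).trans (ContinuousLinearEquiv.finTwoArrow ℝ ℝ)).symm

theorem planeEquiv_apply (p : ℝ × ℝ) : planeEquiv p = !₂[p.1, p.2] := rfl

theorem measurePreserving_planeEquiv : MeasurePreserving planeEquiv :=
  (PiLp.volume_preserving_toLp (Fin 2)).comp (volume_preserving_finTwoArrow ℝ).symm

/-- The identification of `ℝ × ℝ` with the plane that exchanges the coordinates. -/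
noncomputable def planeEquivSwap : (ℝ × ℝ) ≃L[ℝ] Plane :=
  (ContinuousLinearEquiv.prodComm ℝ ℝ ℝ).trans planeEquiv

theorem planeEquivSwap_apply (p : ℝ × ℝ) : planeEquivSwap p = !₂[p.2, p.1] := rfl

theorem measurePreserving_planeEquivSwap : MeasurePreserving planeEquivSwap :=
  measurePreserving_planeEquiv.comp Measure.measurePreserving_swap

theorem measurableEmbedding_equiv (e : (ℝ × ℝ) ≃L[ℝ] Plane) : MeasurableEmbedding e :=
  e.toHomeomorph.measurableEmbedding

end ChangeOfVariables

/-! ### Plancherel in one of two variables -/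

section Slices

/-- The restriction of a Schwartz function on `ℝ × ℝ` to a vertical line. -/
noncomputable def verticalSlice (Φ : 𝓢(ℝ × ℝ, ℝ)) (x : ℝ) : 𝓢(ℝ, ℝ) :=
  SchwartzMap.compCLMOfAntilipschitz ℝ (K := 1) (g := fun y => (x, y))
    (by
      have h := (Function.HasTemperateGrowth.const ((x, 0) : ℝ × ℝ) (E := ℝ)).add
        (ContinuousLinearMap.inr ℝ ℝ ℝ).hasTemperateGrowth
      convert h using 1
      ext y <;> simp)
    (Isometry.antilipschitz (Isometry.of_dist_eq fun y z => by simp [Prod.dist_eq])) Φ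

theorem verticalSlice_apply (Φ : 𝓢(ℝ × ℝ, ℝ)) (x y : ℝ) : verticalSlice Φ x y = Φ (x, y) := rfl

theorem lineDerivOp_verticalSlice (Φ : 𝓢(ℝ × ℝ, ℝ)) (x y : ℝ) :
    ∂_{(1 : ℝ)} (verticalSlice Φ x) y = ∂_{((0 : ℝ), (1 : ℝ))} Φ (x, y) := by
  have h : HasFDerivAt (fun y : ℝ => (x, y)) (ContinuousLinearMap.inr ℝ ℝ ℝ) y :=
    hasFDerivAt_prodMk_right x y
  have h2 := (Φ.hasFDerivAt (x, y)).comp y h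
  rw [SchwartzMap.lineDerivOp_apply_eq_fderiv, SchwartzMap.lineDerivOp_apply_eq_fderiv]
  erw [h2.fderiv]
  simp

theorem integrable_sq_add_sq {D : Type*} [NormedAddCommGroup D] [NormedSpace ℝ D]
    [FiniteDimensional ℝ D] [MeasurableSpace D] [BorelSpace D] (μ : Measure D)
    [μ.IsAddHaarMeasure] (Φ : 𝓢(D, ℝ)) {r : D → ℝ} (hr : r.HasTemperateGrowth) (v : D) :
    Integrable (fun p => (∂_{v} Φ p) ^ 2 + (r p * Φ p) ^ 2) μ := by
  have h1 := integrable_norm_sq μ (∂_{v} Φ)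
  have h2 := integrable_norm_sq μ (SchwartzMap.smulLeftCLM ℝ r Φ)
  simp only [SchwartzMap.smulLeftCLM_apply_apply hr, Real.norm_eq_abs, sq_abs, smul_eq_mul] at h1 h2
  exact h1.add h2

theorem stronglyMeasurable_fourier_chirp_slice (Φ : 𝓢(ℝ × ℝ, ℝ)) {q : ℝ → ℝ}
    (hq : q.HasTemperateGrowth) :
    StronglyMeasurable (fun p : ℝ × ℝ => 𝓕 (chirp q (verticalSlice Φ p.1) : ℝ → ℂ) p.2) := by
  have hqc : Continuous q := hq.1.continuous
  have h : StronglyMeasurable (fun z : (ℝ × ℝ) × ℝ =>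
      Complex.exp (↑(-2 * Real.pi * (z.2 * z.1.2)) * Complex.I) •
        (Complex.exp (q z.2 * Complex.I) * (Φ (z.1.1, z.2) : ℂ))) := by
    have := Φ.continuous
    apply Continuous.stronglyMeasurable
    fun_prop
  have h2 := h.integral_prod_right' (ν := (volume : Measure ℝ))
  convert h2 using 2 with p
  rw [Real.fourier_eq']
  congr 1
  funext y
  rw [chirp_apply hq, verticalSlice_apply]
  simp [mul_comm]

/-- Serves the case of one vanishing `b`, where only one variable is Fourier transformed: the
one-dimensional identity holds on every slice and Fubini assembles the slices. -/
theorem integrable_and_integral_fourier_slices (Φ : 𝓢(ℝ × ℝ, ℝ)) {q q' : ℝ → ℝ}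
    (hq : q.HasTemperateGrowth) (hq' : q'.HasTemperateGrowth)
    (hqq' : ∀ y, HasDerivAt q (q' y) y) :
    Integrable (fun p : ℝ × ℝ => p.2 ^ 2 * ‖𝓕 (chirp q (verticalSlice Φ p.1) : ℝ → ℂ) p.2‖ ^ 2) ∧
    ∫ p : ℝ × ℝ, p.2 ^ 2 * ‖𝓕 (chirp q (verticalSlice Φ p.1) : ℝ → ℂ) p.2‖ ^ 2
      = 1 / (4 * Real.pi ^ 2) *
        ∫ p : ℝ × ℝ, ((∂_{((0 : ℝ), (1 : ℝ))} Φ p) ^ 2 + (q' p.2 * Φ p) ^ 2) := by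
  have hvol : (volume : Measure (ℝ × ℝ)).IsAddHaarMeasure := by
    rw [Measure.volume_eq_prod]; infer_instance
  have hs : Integrable (fun p : ℝ × ℝ =>
      (∂_{((0 : ℝ), (1 : ℝ))} Φ p) ^ 2 + (q' p.2 * Φ p) ^ 2) :=
    integrable_sq_add_sq volume Φ
      (hq'.comp (ContinuousLinearMap.snd ℝ ℝ ℝ).hasTemperateGrowth) ((0 : ℝ), (1 : ℝ))
  have hslice : ∀ x, ∫ y, y ^ 2 * ‖𝓕 (chirp q (verticalSlice Φ x) : ℝ → ℂ) y‖ ^ 2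
      = 1 / (4 * Real.pi ^ 2) *
        ∫ y, ((∂_{((0 : ℝ), (1 : ℝ))} Φ (x, y)) ^ 2 + (q' y * Φ (x, y)) ^ 2) := by
    intro x
    have h := integral_inner_sq_mul_norm_fourier_chirp_sq hq (verticalSlice Φ x) (1 : ℝ)
    simpa [lineDerivOp_verticalSlice, verticalSlice_apply, (hqq' _).deriv] using h
  have hslice' : ∀ x,
      Integrable (fun y => y ^ 2 * ‖𝓕 (chirp q (verticalSlice Φ x) : ℝ → ℂ) y‖ ^ 2) := by
    intro x
    simpa using integrable_inner_sq_mul_norm_fourier_sq (chirp q (verticalSlice Φ x)) (1 : ℝ)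
  have hmeas : AEStronglyMeasurable (fun p : ℝ × ℝ =>
      p.2 ^ 2 * ‖𝓕 (chirp q (verticalSlice Φ p.1) : ℝ → ℂ) p.2‖ ^ 2) volume :=
    ((measurable_snd.pow_const 2).stronglyMeasurable.mul
      ((stronglyMeasurable_fourier_chirp_slice Φ hq).norm.pow 2)).aestronglyMeasurable
  rw [Measure.volume_eq_prod] at hs hmeas ⊢
  have hint : Integrable (fun p : ℝ × ℝ =>
      p.2 ^ 2 * ‖𝓕 (chirp q (verticalSlice Φ p.1) : ℝ → ℂ) p.2‖ ^ 2)
      ((volume : Measure ℝ).prod volume) := by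
    rw [integrable_prod_iff hmeas]
    refine ⟨Filter.Eventually.of_forall hslice', ?_⟩
    -- By nonnegativity the slice integrals of the norm are those of `hslice`, which are integrable
    -- in `x` by `hs`.
    have : ∀ x y : ℝ, ‖y ^ 2 * ‖𝓕 (chirp q (verticalSlice Φ x) : ℝ → ℂ) y‖ ^ 2‖
        = y ^ 2 * ‖𝓕 (chirp q (verticalSlice Φ x) : ℝ → ℂ) y‖ ^ 2 :=
      fun x y => Real.norm_of_nonneg (by positivity)
    simp only [this, hslice]
    exact hs.integral_prod_left.const_mul _
  refine ⟨hint, ?_⟩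
  rw [integral_prod _ hint, integral_prod _ hs, ← integral_const_mul]
  simp only [hslice]

end Slices

/-! ### Phases of the kernels -/

section Phase

/-- The part of the phase of `kernel ν A` that depends on the signal variable only. -/
noncomputable def chirpPhase (A : Params) (x : ℝ) : ℝ :=
  (A.a * x ^ 2 + 2 * x * A.τ) * (1 / (2 * A.b))

/-- The derivative of `chirpPhase A`. -/
noncomputable def chirpPhaseDeriv (A : Params) (x : ℝ) : ℝ :=
  (A.a * x + A.τ) * (1 / A.b)

/-- The part of the phase of `kernel ν A` that depends on the frequency variable only. -/
noncomputable def frequencyPhase (A : Params) (u : ℝ) : ℝ :=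
  -(SignType.sign A.b : ℝ) * (Real.pi / 4) +
    (-2 * u * (A.d * A.τ - A.b * A.η) + A.d * (u ^ 2 + A.τ ^ 2)) * (1 / (2 * A.b))

/-- Isolates the only term coupling `t` and `u`; it is a Fourier phase at frequency `u / (2π b)`,
the weight of the theorem. -/
theorem kernelPhase_eq {A : Params} (hb : A.b ≠ 0) (t u : ℝ) :
    kernelPhase A t u
      = chirpPhase A t - 2 * Real.pi * (t * (u / (2 * Real.pi * A.b))) + frequencyPhase A u := by
  have := Real.pi_ne_zero
  unfold kernelPhase chirpPhase frequencyPhase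
  field_simp
  ring

theorem measurable_kernelPhase (A : Params) (u : ℝ) : Measurable fun t => kernelPhase A t u := by
  unfold kernelPhase
  fun_prop

theorem hasTemperateGrowth_chirpPhase (A : Params) : (chirpPhase A).HasTemperateGrowth := by
  unfold chirpPhase
  fun_prop

theorem hasTemperateGrowth_chirpPhaseDeriv (A : Params) :
    (chirpPhaseDeriv A).HasTemperateGrowth := by
  unfold chirpPhaseDeriv
  fun_prop

theorem hasDerivAt_chirpPhase (A : Params) (x : ℝ) :
    HasDerivAt (chirpPhase A) (chirpPhaseDeriv A x) x := by
  have h : HasDerivAt (chirpPhase A) _ x := ((((hasDerivAt_id x).pow 2).const_mul A.a).add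
    (((hasDerivAt_id x).const_mul 2).mul_const A.τ)).mul_const (1 / (2 * A.b))
  convert h using 1
  simp [chirpPhaseDeriv]
  ring

theorem hasTemperateGrowth_coord (i : Fin 2) :
    (fun s : Plane => s i).HasTemperateGrowth :=
  (EuclideanSpace.proj (𝕜 := ℝ) i).hasTemperateGrowth

/-- The phase `α + ε β` of the two kernels, restricted to the signal variable. -/
noncomputable def planeChirp (A : Fin 2 → Params) (ε : ℝ) (s : Plane) : ℝ :=
  chirpPhase (A 0) (s 0) + ε * chirpPhase (A 1) (s 1)

theorem hasTemperateGrowth_planeChirp (A : Fin 2 → Params) (ε : ℝ) :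
    (planeChirp A ε).HasTemperateGrowth :=
  ((hasTemperateGrowth_chirpPhase (A 0)).comp (hasTemperateGrowth_coord 0)).add
    ((Function.HasTemperateGrowth.const ε).mul
      ((hasTemperateGrowth_chirpPhase (A 1)).comp (hasTemperateGrowth_coord 1)))

/-- The sign `ε` is lost on squaring, so the phases `α + β` and `α - β` have equal energy. -/
theorem fderiv_planeChirp_sq (A : Fin 2 → Params) {ε : ℝ} (hε : ε ^ 2 = 1) (k : Fin 2) (s : Plane) :
    (fderiv ℝ (planeChirp A ε) s (EuclideanSpace.single k 1)) ^ 2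
      = (chirpPhaseDeriv (A k) (s k)) ^ 2 := by
  have h : ∀ i, HasFDerivAt (fun s : Plane => chirpPhase (A i) (s i))
      (chirpPhaseDeriv (A i) (s i) • EuclideanSpace.proj (𝕜 := ℝ) i) s := fun i =>
    (hasDerivAt_chirpPhase (A i) (s i)).comp_hasFDerivAt (f := fun s : Plane => s i) s
      (EuclideanSpace.proj (𝕜 := ℝ) i).hasFDerivAt
  have h2 : HasFDerivAt (planeChirp A ε) _ s := (h 0).add ((h 1).const_mul ε)
  rw [h2.fderiv]
  fin_cases k
  · simp
  · simp [mul_pow, hε]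

end Phase

/-! ### Weighted energy of the transform of a real signal -/

section QOLCTNorm

theorem integrable_and_integral_of_comp_affine {e : (ℝ × ℝ) ≃L[ℝ] Plane} (he : MeasurePreserving e)
    {G : ℝ × ℝ → ℝ} (hG : Integrable G) {c c' : ℝ} (hc : c ≠ 0) (hc' : c' ≠ 0) {d d' C : ℝ}
    {I : Plane → ℝ} (hI : ∀ p, I (e p) = C * G (c * p.1 + d, c' * p.2 + d')) :
    Integrable I ∧ |c| * |c'| * ∫ ξ, I ξ = C * ∫ p, G p := by
  obtain ⟨h1, h2⟩ := integrable_and_integral_comp_affine hG hc hc' d d'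
  have hemb := measurableEmbedding_equiv e
  constructor
  · rw [← he.integrable_comp_emb hemb]
    exact (h1.const_mul C).congr (Filter.Eventually.of_forall fun p => (hI p).symm)
  · rw [← he.integral_comp hemb]
    simp only [hI]
    rw [integral_const_mul, ← h2]
    ring

/-- The squared modulus of the transform of a real signal when one of the parameters `b` is zero,
integrated against the squared frequency. -/
theorem integrable_and_integral_degenerate {e : (ℝ × ℝ) ≃L[ℝ] Plane} (he : MeasurePreserving e)
    {k : Fin 2} (hek : ∀ p, (e p) k = p.2) (he1 : e (0, 1) = EuclideanSpace.single k 1)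
    {B D : Params} (hB : B.b ≠ 0) (hD : D.b = 0) (φ : 𝓢(Plane, ℝ)) {N : Plane → ℝ}
    (hN : ∀ p, N (e p) = 1 / (2 * Real.pi * |B.b|) * |D.d| *
      ‖∫ y, Complex.exp (kernelPhase B y p.2 * Complex.I) * φ (e (D.d * (p.1 - D.τ), y))‖ ^ 2) :
    Integrable (fun ξ : Plane => (ξ k / (2 * Real.pi * B.b)) ^ 2 * N ξ) ∧
    ∫ ξ : Plane, (ξ k / (2 * Real.pi * B.b)) ^ 2 * N ξ = 1 / (4 * Real.pi ^ 2) *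
      ∫ s : Plane, ((∂_{(EuclideanSpace.single k 1 : Plane)} φ s) ^ 2
        + (chirpPhaseDeriv B (s k) * φ s) ^ 2) := by
  have hpi := Real.pi_pos
  -- With `b = 0` the determinant condition reads `a d = 1`.
  have hd : D.d ≠ 0 := by
    intro h
    have := D.det_eq_one
    rw [hD, h] at this
    simp at this
  have hBpos := abs_pos.2 hB
  have hdpos := abs_pos.2 hd
  set Φ : 𝓢(ℝ × ℝ, ℝ) := SchwartzMap.compCLMOfContinuousLinearEquiv ℝ e φ with hΦ
  obtain ⟨h1, h2⟩ := integrable_and_integral_fourier_slices Φ (hasTemperateGrowth_chirpPhase B)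
    (hasTemperateGrowth_chirpPhaseDeriv B) (hasDerivAt_chirpPhase B)
  have hc' : 1 / (2 * Real.pi * B.b) ≠ 0 := by positivity
  obtain ⟨h3, h4⟩ := integrable_and_integral_of_comp_affine he h1 hd hc' (d := -(D.d * D.τ))
    (d' := 0) (C := 1 / (2 * Real.pi * |B.b|) * |D.d|)
    (I := fun ξ : Plane => (ξ k / (2 * Real.pi * B.b)) ^ 2 * N ξ) (by
      intro p
      have h5 := norm_integral_phase_eq_norm_fourier_chirp (hasTemperateGrowth_chirpPhase B)
        (verticalSlice Φ (D.d * (p.1 - D.τ))) (p.2 / (2 * Real.pi * B.b))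
        (fun y => kernelPhase B y p.2) (frequencyPhase B p.2) (fun y => by
          rw [kernelPhase_eq hB]
          simp [mul_comm])
      have h6 : D.d * p.1 + -(D.d * D.τ) = D.d * (p.1 - D.τ) := by ring
      have h7 : 1 / (2 * Real.pi * B.b) * p.2 + 0 = p.2 / (2 * Real.pi * B.b) := by ring
      simp only [h6, h7, hN, hek, ← h5]
      simp only [verticalSlice_apply, hΦ, SchwartzMap.compCLMOfContinuousLinearEquiv_apply,
        Function.comp_apply]
      ring)
  refine ⟨h3, ?_⟩
  -- The Jacobian equals the squared kernel constant times `|√d|²`, so the two cancel.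
  have h8 : |D.d| * |1 / (2 * Real.pi * B.b)| = 1 / (2 * Real.pi * |B.b|) * |D.d| := by
    rw [abs_div, abs_mul, abs_of_pos (show (0 : ℝ) < 2 * Real.pi by positivity), abs_one]
    ring
  rw [h8] at h4
  rw [mul_left_cancel₀ (by positivity) h4, h2, ← he.integral_comp (measurableEmbedding_equiv e)]
  congr 2
  funext p
  rw [hΦ, SchwartzMap.lineDerivOp_compCLMOfContinuousLinearEquiv, he1, hek]
  rfl

theorem integrable_and_integral_phase {A : Fin 2 → Params} (h0 : (A 0).b ≠ 0) (h1 : (A 1).b ≠ 0)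
    {ε : ℝ} (hε : ε ^ 2 = 1) (φ : 𝓢(Plane, ℝ)) (k : Fin 2) :
    Integrable (fun ξ : Plane => (ξ k / (2 * Real.pi * (A k).b)) ^ 2 *
      (1 / (2 * Real.pi * |(A 0).b|) * (1 / (2 * Real.pi * |(A 1).b|)) *
        ‖∫ s : Plane, Complex.exp (↑(kernelPhase (A 0) (s 0) (ξ 0)
          + ε * kernelPhase (A 1) (s 1) (ξ 1)) * Complex.I) * φ s‖ ^ 2)) ∧
    ∫ ξ : Plane, (ξ k / (2 * Real.pi * (A k).b)) ^ 2 *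
      (1 / (2 * Real.pi * |(A 0).b|) * (1 / (2 * Real.pi * |(A 1).b|)) *
        ‖∫ s : Plane, Complex.exp (↑(kernelPhase (A 0) (s 0) (ξ 0)
          + ε * kernelPhase (A 1) (s 1) (ξ 1)) * Complex.I) * φ s‖ ^ 2) = 1 / (4 * Real.pi ^ 2) *
      ∫ s : Plane, ((∂_{(EuclideanSpace.single k 1 : Plane)} φ s) ^ 2
        + (chirpPhaseDeriv (A k) (s k) * φ s) ^ 2) := by
  have hpi := Real.pi_pos
  have hε0 : ε ≠ 0 := by rintro rfl; norm_num at hε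
  have habs : |ε| = 1 := by
    rw [← sq_abs] at hε
    nlinarith [abs_nonneg ε]
  have hp0 := abs_pos.2 h0
  have hp1 := abs_pos.2 h1
  have hQ := hasTemperateGrowth_planeChirp A ε
  set v : Plane := EuclideanSpace.single k 1 with hv
  set H : Plane → ℝ := fun w => ⟪w, v⟫ ^ 2 * ‖𝓕 (chirp (planeChirp A ε) φ : Plane → ℂ) w‖ ^ 2
    with hH
  have hHi : Integrable H := integrable_inner_sq_mul_norm_fourier_sq (chirp (planeChirp A ε) φ) v
  have hHv := integral_inner_sq_mul_norm_fourier_chirp_sq hQ φ v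
  have he := measurePreserving_planeEquiv
  have hemb := measurableEmbedding_equiv planeEquiv
  have hc : 1 / (2 * Real.pi * (A 0).b) ≠ 0 := by positivity
  -- The sign of the second phase is absorbed by reflecting the second frequency.
  have hc' : ε / (2 * Real.pi * (A 1).b) ≠ 0 := by positivity
  obtain ⟨h3, h4⟩ := integrable_and_integral_of_comp_affine he
    ((he.integrable_comp_emb hemb).2 hHi) hc hc' (d := 0) (d' := 0)
    (C := 1 / (2 * Real.pi * |(A 0).b|) * (1 / (2 * Real.pi * |(A 1).b|)))
    (I := fun ξ : Plane => (ξ k / (2 * Real.pi * (A k).b)) ^ 2 *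
      (1 / (2 * Real.pi * |(A 0).b|) * (1 / (2 * Real.pi * |(A 1).b|)) *
        ‖∫ s : Plane, Complex.exp (↑(kernelPhase (A 0) (s 0) (ξ 0)
          + ε * kernelPhase (A 1) (s 1) (ξ 1)) * Complex.I) * φ s‖ ^ 2)) (by
      intro p
      have h5 := norm_integral_phase_eq_norm_fourier_chirp hQ φ
        (planeEquiv (1 / (2 * Real.pi * (A 0).b) * p.1 + 0, ε / (2 * Real.pi * (A 1).b) * p.2 + 0))
        (fun s => kernelPhase (A 0) (s 0) p.1 + ε * kernelPhase (A 1) (s 1) p.2)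
        (frequencyPhase (A 0) p.1 + ε * frequencyPhase (A 1) p.2) (fun s => by
          rw [kernelPhase_eq h0, kernelPhase_eq h1]
          simp only [planeEquiv_apply, PiLp.inner_apply, Fin.sum_univ_two, planeChirp]
          simp
          ring)
      have h6 : ⟪planeEquiv (1 / (2 * Real.pi * (A 0).b) * p.1 + 0,
          ε / (2 * Real.pi * (A 1).b) * p.2 + 0), v⟫ ^ 2
          = ((planeEquiv p) k / (2 * Real.pi * (A k).b)) ^ 2 := by
        rw [hv, EuclideanSpace.inner_single_right, planeEquiv_apply, planeEquiv_apply]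
        fin_cases k
        · simp
          ring
        · simp
          rw [div_mul_eq_mul_div, div_pow, mul_pow, hε, div_pow, one_mul]
      simp only [Function.comp_apply, hH, h6, ← h5]
      simp only [planeEquiv_apply, Matrix.cons_val_zero, Matrix.cons_val_one,
        Matrix.cons_val_fin_one]
      ring)
  refine ⟨h3, ?_⟩
  have h8 : |1 / (2 * Real.pi * (A 0).b)| * |ε / (2 * Real.pi * (A 1).b)|
      = 1 / (2 * Real.pi * |(A 0).b|) * (1 / (2 * Real.pi * |(A 1).b|)) := by
    rw [abs_div, abs_div, abs_mul (2 * Real.pi), abs_mul (2 * Real.pi),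
      abs_of_pos (show (0 : ℝ) < 2 * Real.pi by positivity),
      abs_one, habs]
  rw [h8] at h4
  rw [mul_left_cancel₀ (by positivity) h4]
  have h9 := he.integral_comp hemb H
  simp only [Function.comp_apply]
  rw [h9, hHv]
  simp only [mul_pow, hv, fderiv_planeChirp_sq A hε]

theorem integrable_and_integral_norm_qolct_sq {lam mu : ℍ[ℝ]} (hlam : lam ^ 2 = -1)
    (hmu : mu ^ 2 = -1) (A : Fin 2 → Params) (φ : 𝓢(Plane, ℝ)) {k : Fin 2} (hb : (A k).b ≠ 0) :
    Integrable (fun ξ : Plane => (ξ k / (2 * Real.pi * (A k).b)) ^ 2 *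
      ‖qolct lam mu A (fun s => (φ s : ℍ[ℝ])) ξ‖ ^ 2) ∧
    ∫ ξ : Plane, (ξ k / (2 * Real.pi * (A k).b)) ^ 2 *
      ‖qolct lam mu A (fun s => (φ s : ℍ[ℝ])) ξ‖ ^ 2 = 1 / (4 * Real.pi ^ 2) *
      ∫ s : Plane, ((∂_{(EuclideanSpace.single k 1 : Plane)} φ s) ^ 2
        + (chirpPhaseDeriv (A k) (s k) * φ s) ^ 2) := by
  by_cases h0 : (A 0).b = 0
  · have hk : k = 1 := by
      fin_cases k
      · exact absurd h0 hb
      · rfl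
    subst hk
    refine integrable_and_integral_degenerate measurePreserving_planeEquiv (k := 1)
      (fun p => rfl) ?_ hb h0 φ fun p => ?_
    · ext i
      fin_cases i <;> simp [planeEquiv_apply]
    · simp only [qolct, h0, hb, ne_eq, not_true_eq_false, not_false_eq_true, if_true, if_false,
        kernel_eq hmu, planeEquiv_apply, Matrix.cons_val_zero, Matrix.cons_val_one,
        Matrix.cons_val_fin_one]
      have hi : Integrable fun y : ℝ => φ !₂[(A 0).d * (p.1 - (A 0).τ), y] :=
        (verticalSlice (SchwartzMap.compCLMOfContinuousLinearEquiv ℝ planeEquiv φ) _).integrable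
      rw [norm_integral_right_sq hmu (measurable_kernelPhase _ _) hi, one_div_sqrt_sq,
        norm_degenerateFactor_sq hlam]
  · by_cases h1 : (A 1).b = 0
    · have hk : k = 0 := by
        fin_cases k
        · rfl
        · exact absurd h1 hb
      subst hk
      refine integrable_and_integral_degenerate measurePreserving_planeEquivSwap (k := 0)
        (fun p => rfl) ?_ hb h1 φ fun p => ?_
      · ext i
        fin_cases i <;> simp [planeEquivSwap_apply]
      · simp only [qolct, h1, hb, ne_eq, not_true_eq_false, not_false_eq_true, if_true, if_false,
          kernel_eq hlam, planeEquivSwap_apply, Matrix.cons_val_zero, Matrix.cons_val_one,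
          Matrix.cons_val_fin_one]
        have hi : Integrable fun y : ℝ => φ !₂[y, (A 1).d * (p.1 - (A 1).τ)] :=
          (verticalSlice
            (SchwartzMap.compCLMOfContinuousLinearEquiv ℝ planeEquivSwap φ) _).integrable
        rw [norm_integral_left_sq hlam (measurable_kernelPhase _ _) hi, one_div_sqrt_sq,
          norm_degenerateFactor_sq hmu]
    -- Both signs give the same integral, and the weights `(1 ± ⟨λ,μ⟩)/2` sum to 1.
    · obtain ⟨i1, v1⟩ := integrable_and_integral_phase h0 h1 (ε := 1) (by norm_num) φ k
      obtain ⟨i2, v2⟩ := integrable_and_integral_phase h0 h1 (ε := -1) (by norm_num) φ k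
      have hsplit : ∀ ξ : Plane, (ξ k / (2 * Real.pi * (A k).b)) ^ 2 *
          ‖qolct lam mu A (fun s => (φ s : ℍ[ℝ])) ξ‖ ^ 2 =
          (1 + imInner lam mu) / 2 * ((ξ k / (2 * Real.pi * (A k).b)) ^ 2 *
            (1 / (2 * Real.pi * |(A 0).b|) * (1 / (2 * Real.pi * |(A 1).b|)) *
              ‖∫ s : Plane, Complex.exp (↑(kernelPhase (A 0) (s 0) (ξ 0)
                + 1 * kernelPhase (A 1) (s 1) (ξ 1)) * Complex.I) * φ s‖ ^ 2))
          + (1 - imInner lam mu) / 2 * ((ξ k / (2 * Real.pi * (A k).b)) ^ 2 *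
            (1 / (2 * Real.pi * |(A 0).b|) * (1 / (2 * Real.pi * |(A 1).b|)) *
              ‖∫ s : Plane, Complex.exp (↑(kernelPhase (A 0) (s 0) (ξ 0)
                + -1 * kernelPhase (A 1) (s 1) (ξ 1)) * Complex.I) * φ s‖ ^ 2)) := by
        intro ξ
        have m0 : Measurable fun s : Plane => kernelPhase (A 0) (s 0) (ξ 0) :=
          (measurable_kernelPhase (A 0) (ξ 0)).comp (by fun_prop)
        have m1 : Measurable fun s : Plane => kernelPhase (A 1) (s 1) (ξ 1) :=
          (measurable_kernelPhase (A 1) (ξ 1)).comp (by fun_prop)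
        simp only [qolct, h0, h1, ne_eq, not_false_eq_true, if_true, kernel_eq hlam, kernel_eq hmu]
        rw [norm_integral_two_sided_sq hlam hmu m0 m1 φ.integrable, one_div_sqrt_sq,
          one_div_sqrt_sq]
        simp only [one_mul, neg_one_mul, ← sub_eq_add_neg]
        ring
      simp only [hsplit]
      refine ⟨(i1.const_mul _).add (i2.const_mul _), ?_⟩
      rw [integral_add (i1.const_mul _) (i2.const_mul _), integral_const_mul, integral_const_mul,
        v1, v2]
      ring

end QOLCTNorm

/-! ### The cross signal and its square integrability -/

section CrossSignal

/-- The map is the shear `(t, s) ↦ (t + s/2, s)` followed by `(u, s) ↦ (u, u - s)`, each preserving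
volume fibrewise. -/
theorem measurePreserving_add_half_sub_half :
    MeasurePreserving (fun p : Plane × Plane => (p.1 + (1 / 2 : ℝ) • p.2, p.1 - (1 / 2 : ℝ) • p.2))
      (volume.prod volume) (volume.prod volume) := by
  have h1 : MeasurePreserving (fun p : Plane × Plane => (p.1, p.2 + (1 / 2 : ℝ) • p.1))
      (volume.prod volume) (volume.prod volume) :=
    (MeasurePreserving.id volume).skew_product (g := fun s t : Plane => t + (1 / 2 : ℝ) • s)
      (by fun_prop)
      (Filter.Eventually.of_forall fun s => (measurePreserving_add_right volume _).map_eq)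
  have h2 : MeasurePreserving (fun p : Plane × Plane => (p.1, p.1 - p.2))
      (volume.prod volume) (volume.prod volume) :=
    (MeasurePreserving.id volume).skew_product (g := fun u s : Plane => u - s)
      (by fun_prop)
      (Filter.Eventually.of_forall fun u => (Measure.measurePreserving_sub_left volume u).map_eq)
  have h3 := h2.comp ((Measure.measurePreserving_swap (μ := (volume : Measure Plane))
    (ν := (volume : Measure Plane))).comp (h1.comp Measure.measurePreserving_swap))
  convert h3 using 1
  funext p
  ext1
  · rfl
  · simp only [Function.comp_apply, Prod.swap]
    module

theorem crossSignal_eq (f g : Plane → ℍ[ℝ]) (t s : Plane) :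
    crossSignal f g t s = f (t + (1 / 2 : ℝ) • s) * star (g (t - (1 / 2 : ℝ) • s)) := rfl

theorem integrable_and_integral_norm_crossSignal_sq (f g : 𝓢(Plane, ℍ[ℝ])) :
    Integrable (fun p : Plane × Plane => ‖crossSignal f g p.1 p.2‖ ^ 2) (volume.prod volume) ∧
    ∫ p : Plane × Plane, ‖crossSignal f g p.1 p.2‖ ^ 2 ∂(volume.prod volume)
      = (∫ u, ‖f u‖ ^ 2) * ∫ v, ‖g v‖ ^ 2 := by
  have h := (integrable_norm_sq volume f).mul_prod (integrable_norm_sq volume g)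
  have hT := measurePreserving_add_half_sub_half
  have heq : (fun p : Plane × Plane => ‖crossSignal f g p.1 p.2‖ ^ 2)
      = (fun z : Plane × Plane => ‖f z.1‖ ^ 2 * ‖g z.2‖ ^ 2) ∘
        fun p : Plane × Plane => (p.1 + (1 / 2 : ℝ) • p.2, p.1 - (1 / 2 : ℝ) • p.2) := by
    funext p
    simp only [Function.comp_apply, crossSignal_eq, norm_mul, Quaternion.norm_star, mul_pow]
  constructor
  · rw [heq]
    exact hT.integrable_comp_of_integrable h
  · rw [heq, ← integral_prod_mul]
    have h2 := integral_map hT.measurable.aemeasurable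
      (f := fun z : Plane × Plane => ‖f z.1‖ ^ 2 * ‖g z.2‖ ^ 2)
      (by rw [hT.map_eq]; exact h.aestronglyMeasurable)
    rw [hT.map_eq] at h2
    exact h2.symm

theorem continuous_crossSignal (f g : 𝓢(Plane, ℍ[ℝ])) :
    Continuous fun p : Plane × Plane => crossSignal f g p.1 p.2 := by
  have := f.continuous
  have := g.continuous
  unfold crossSignal
  fun_prop

theorem memLp_crossSignal (f g : 𝓢(Plane, ℍ[ℝ])) :
    MemLp (fun p : Plane × Plane => crossSignal f g p.1 p.2) 2 (volume.prod volume) :=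
  (memLp_two_iff_integrable_sq_norm (continuous_crossSignal f g).aestronglyMeasurable).2
    (integrable_and_integral_norm_crossSignal_sq f g).1

/-- The dilation of the plane by a nonzero real number. -/
noncomputable def planeDilation {c : ℝ} (hc : c ≠ 0) : Plane ≃L[ℝ] Plane :=
  ContinuousLinearEquiv.smulLeft (Units.mk0 c hc)

theorem planeDilation_apply {c : ℝ} (hc : c ≠ 0) (s : Plane) : planeDilation hc s = c • s := rfl

section NormedSpace

variable {E F G : Type*} [NormedAddCommGroup E] [NormedSpace ℝ E] [NormedAddCommGroup F]
  [NormedSpace ℝ F] [NormedAddCommGroup G] [NormedSpace ℝ G]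

/-- The Schwartz function `s ↦ f (t + c s)`. -/
noncomputable def affineComp {c : ℝ} (hc : c ≠ 0) (f : 𝓢(Plane, E)) (t : Plane) :
    𝓢(Plane, E) :=
  SchwartzMap.compCLMOfContinuousLinearEquiv ℝ (planeDilation hc) (f.compSubConstCLM ℝ (-t))

theorem affineComp_apply {c : ℝ} (hc : c ≠ 0) (f : 𝓢(Plane, E)) (t s : Plane) :
    affineComp hc f t s = f (t + c • s) := by
  simp [affineComp, planeDilation_apply, add_comm]

theorem lineDerivOp_affineComp {c : ℝ} (hc : c ≠ 0) (f : 𝓢(Plane, E)) (t s v : Plane) :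
    ∂_{v} (affineComp hc f t) s = c • ∂_{v} f (t + c • s) := by
  have h1 : HasFDerivAt (fun s : Plane => t + c • s) (c • ContinuousLinearMap.id ℝ Plane) s :=
    ((hasFDerivAt_id s).const_smul c).const_add t
  have h2 := (f.hasFDerivAt (t + c • s)).comp s h1
  have h3 : (affineComp hc f t : Plane → E) = f ∘ fun s : Plane => t + c • s :=
    funext (affineComp_apply hc f t)
  rw [SchwartzMap.lineDerivOp_apply_eq_fderiv, SchwartzMap.lineDerivOp_apply_eq_fderiv, h3,
    h2.fderiv]
  simp

theorem lineDerivOp_pairing (B : E →L[ℝ] F →L[ℝ] G) (f : 𝓢(Plane, E)) (g : 𝓢(Plane, F))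
    (s v : Plane) :
    ∂_{v} (SchwartzMap.pairing B f g) s = B (∂_{v} f s) (g s) + B (f s) (∂_{v} g s) := by
  have h := B.hasFDerivAt_of_bilinear (f.hasFDerivAt s) (g.hasFDerivAt s)
  rw [SchwartzMap.lineDerivOp_apply_eq_fderiv, SchwartzMap.lineDerivOp_apply_eq_fderiv,
    SchwartzMap.lineDerivOp_apply_eq_fderiv, SchwartzMap.pairing_apply, h.fderiv]
  simp [add_comm]

/-- The product of a Schwartz function with the `k`-th coordinate. -/
noncomputable def coordMul (k : Fin 2) (f : 𝓢(Plane, E)) : 𝓢(Plane, E) :=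
  SchwartzMap.smulLeftCLM E (fun s : Plane => s k) f

theorem coordMul_apply (k : Fin 2) (f : 𝓢(Plane, E)) (s : Plane) :
    coordMul k f s = s k • f s := by
  simp [coordMul, SchwartzMap.smulLeftCLM_apply_apply (hasTemperateGrowth_coord k)]

theorem lineDerivOp_coordMul (k : Fin 2) (f : 𝓢(Plane, E)) (s : Plane) :
    ∂_{(EuclideanSpace.single k 1 : Plane)} (coordMul k f) s
      = f s + s k • ∂_{(EuclideanSpace.single k 1 : Plane)} f s := by
  have h1 : HasFDerivAt (fun s : Plane => s k) (EuclideanSpace.proj (𝕜 := ℝ) k) s :=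
    (EuclideanSpace.proj (𝕜 := ℝ) k).hasFDerivAt
  have h2 : HasFDerivAt (fun s : Plane => s k • f s) _ s := h1.smul (f.hasFDerivAt s)
  have h3 : (coordMul k f : Plane → E) = fun s : Plane => s k • f s :=
    funext (coordMul_apply k f)
  rw [SchwartzMap.lineDerivOp_apply_eq_fderiv, SchwartzMap.lineDerivOp_apply_eq_fderiv, h3,
    h2.fderiv]
  simp [add_comm]

end NormedSpace

/-- The real bilinear map `(p, q) ↦ p * star q`. -/
noncomputable def mulStarCLM : ℍ[ℝ] →L[ℝ] ℍ[ℝ] →L[ℝ] ℍ[ℝ] :=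
  ((ContinuousLinearMap.mul ℝ ℍ[ℝ]).flip.comp (LinearMap.toContinuousLinearMap
    { toFun := star
      map_add' := star_add
      map_smul' := fun c q => Quaternion.star_smul c q })).flip

theorem mulStarCLM_apply (p q : ℍ[ℝ]) : mulStarCLM p q = p * star q := rfl

/-- The cross signal of two Schwartz functions, as a Schwartz function of its second variable. -/
noncomputable def crossSchwartz (f g : 𝓢(Plane, ℍ[ℝ])) (t : Plane) : 𝓢(Plane, ℍ[ℝ]) :=
  SchwartzMap.pairing mulStarCLM (affineComp (c := 1 / 2) (by norm_num) f t)
    (affineComp (c := -(1 / 2)) (by norm_num) g t)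

theorem crossSchwartz_apply (f g : 𝓢(Plane, ℍ[ℝ])) (t s : Plane) :
    crossSchwartz f g t s = crossSignal f g t s := by
  rw [crossSchwartz, SchwartzMap.pairing_apply_apply, affineComp_apply, affineComp_apply,
    mulStarCLM_apply, crossSignal_eq, neg_smul, sub_eq_add_neg]

theorem lineDerivOp_crossSchwartz (f g : 𝓢(Plane, ℍ[ℝ])) (t s v : Plane) :
    ∂_{v} (crossSchwartz f g t) s = (1 / 2 : ℝ) • crossSignal (∂_{v} f : 𝓢(Plane, ℍ[ℝ])) g t s
      - (1 / 2 : ℝ) • crossSignal f (∂_{v} g : 𝓢(Plane, ℍ[ℝ])) t s := by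
  rw [crossSchwartz, lineDerivOp_pairing, lineDerivOp_affineComp, lineDerivOp_affineComp,
    affineComp_apply, affineComp_apply, map_smul, map_smul, smul_apply,
    mulStarCLM_apply, mulStarCLM_apply, crossSignal_eq, crossSignal_eq, neg_smul, neg_smul,
    ← sub_eq_add_neg, ← sub_eq_add_neg]

/-- Since `s = (t + s/2) - (t - s/2)`, the weight moves onto `f` and `g`, which stay Schwartz;
square integrability in `(t, s)` follows. -/
theorem coord_smul_crossSignal (k : Fin 2) (f g : 𝓢(Plane, ℍ[ℝ])) (t s : Plane) :
    s k • crossSignal f g t s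
      = crossSignal (coordMul k f) g t s - crossSignal f (coordMul k g) t s := by
  simp only [crossSignal_eq, coordMul_apply, Quaternion.star_smul, smul_mul_assoc,
    mul_smul_comm, ← sub_smul]
  congr 1
  simp
  ring

theorem memLp_coord_smul_crossSignal (k : Fin 2) (f g : 𝓢(Plane, ℍ[ℝ])) :
    MemLp (fun p : Plane × Plane => p.2 k • crossSignal f g p.1 p.2) 2 (volume.prod volume) := by
  simp only [coord_smul_crossSignal]
  exact (memLp_crossSignal _ _).sub (memLp_crossSignal _ _)

theorem memLp_lineDerivOp_crossSchwartz (v : Plane) (f g : 𝓢(Plane, ℍ[ℝ])) :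
    MemLp (fun p : Plane × Plane => ∂_{v} (crossSchwartz f g p.1) p.2) 2 (volume.prod volume) := by
  simp only [lineDerivOp_crossSchwartz]
  exact ((memLp_crossSignal _ _).const_smul (1 / 2 : ℝ)).sub
    ((memLp_crossSignal _ _).const_smul (1 / 2 : ℝ))

theorem memLp_chirpPhaseDeriv_smul_crossSignal (A : Params) (k : Fin 2) (f g : 𝓢(Plane, ℍ[ℝ])) :
    MemLp (fun p : Plane × Plane => chirpPhaseDeriv A (p.2 k) • crossSignal f g p.1 p.2) 2
      (volume.prod volume) := by
  have h : (fun p : Plane × Plane => chirpPhaseDeriv A (p.2 k) • crossSignal f g p.1 p.2)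
      = (fun p => (A.a * (1 / A.b)) • (p.2 k • crossSignal f g p.1 p.2))
        + fun p => (A.τ * (1 / A.b)) • crossSignal f g p.1 p.2 := by
    funext p
    simp only [Pi.add_apply, chirpPhaseDeriv]
    module
  rw [h]
  exact ((memLp_coord_smul_crossSignal k f g).const_smul (A.a * (1 / A.b))).add
    ((memLp_crossSignal f g).const_smul (A.τ * (1 / A.b)))

end CrossSignal

/-! ### The Heisenberg inequality in quadratic form -/

section Heisenberg

variable {F : Type*} [NormedAddCommGroup F] [InnerProductSpace ℝ F]

/-- Expand `∫ ‖s_k h + x ∂_k h‖² ≥ 0`; by parts, `2 ∫ ⟨s_k h, ∂_k h⟩ = -∫ ‖h‖²`. Unlike the product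
inequality, this form is linear in the three integrals and can be integrated over `t`. -/
theorem quadratic_heisenberg (h : 𝓢(Plane, F)) (k : Fin 2) (x : ℝ) :
    0 ≤ (∫ s : Plane, ‖s k • h s‖ ^ 2) - x * (∫ s : Plane, ‖h s‖ ^ 2)
      + x ^ 2 * ∫ s : Plane, ‖∂_{(EuclideanSpace.single k 1 : Plane)} h s‖ ^ 2 := by
  set v : Plane := EuclideanSpace.single k 1 with hv
  have hparts : ∫ s, ⟪coordMul k h s, ∂_{v} h s⟫ = -∫ s, ⟪∂_{v} (coordMul k h) s, h s⟫ :=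
    SchwartzMap.integral_bilinear_lineDerivOp_right_eq_neg_left (coordMul k h) h (innerSL ℝ) v
  simp only [hv, lineDerivOp_coordMul, coordMul_apply, inner_add_left, real_inner_smul_left]
    at hparts
  simp only [← hv] at hparts
  have hi1 : Integrable fun s : Plane => ⟪h s, h s⟫ :=
    (SchwartzMap.pairing (innerSL ℝ) h h).integrable
  have hi2 : Integrable fun s : Plane => s k * ⟪h s, ∂_{v} h s⟫ := by
    have := (SchwartzMap.pairing (innerSL ℝ) (coordMul k h) (∂_{v} h)).integrable (μ := volume)
    refine this.congr (Filter.Eventually.of_forall fun s => ?_)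
    rw [SchwartzMap.pairing_apply_apply, innerSL_apply_apply, coordMul_apply, real_inner_smul_left]
  have hcomm : ∀ s : Plane, ⟪∂_{v} h s, h s⟫ = ⟪h s, ∂_{v} h s⟫ := fun s => real_inner_comm _ _
  simp only [hcomm] at hparts
  rw [integral_add hi1 hi2] at hparts
  have hN : ∫ s : Plane, ‖h s‖ ^ 2 = ∫ s : Plane, ⟪h s, h s⟫ := by
    simp only [real_inner_self_eq_norm_sq]
  have hP : Integrable fun s : Plane => ‖s k • h s‖ ^ 2 := by
    simpa only [coordMul_apply] using integrable_norm_sq volume (coordMul k h)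
  have hD := integrable_norm_sq volume (∂_{v} h)
  have hexp : ∀ s : Plane, ‖s k • h s + x • ∂_{v} h s‖ ^ 2
      = ‖s k • h s‖ ^ 2 + 2 * x * (s k * ⟪h s, ∂_{v} h s⟫) + x ^ 2 * ‖∂_{v} h s‖ ^ 2 := by
    intro s
    rw [norm_add_sq_real, real_inner_smul_left, real_inner_smul_right, norm_smul x, mul_pow,
      Real.norm_eq_abs, sq_abs]
    ring
  have hpos : 0 ≤ ∫ s : Plane, ‖s k • h s + x • ∂_{v} h s‖ ^ 2 :=
    integral_nonneg fun s => sq_nonneg _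
  simp only [hexp] at hpos
  have hPi : Integrable fun s : Plane =>
      ‖s k • h s‖ ^ 2 + 2 * x * (s k * ⟪h s, ∂_{v} h s⟫) := hP.add (hi2.const_mul _)
  rw [integral_add hPi (hD.const_mul _), integral_add hP (hi2.const_mul _),
    integral_const_mul, integral_const_mul] at hpos
  rw [hN]
  linear_combination hpos + x * hparts

theorem quadratic_heisenberg_add (h : 𝓢(Plane, F)) (k : Fin 2) {r : ℝ → ℝ}
    (hr : r.HasTemperateGrowth) (x : ℝ) :
    0 ≤ (∫ s : Plane, ‖s k • h s‖ ^ 2) - x * (∫ s : Plane, ‖h s‖ ^ 2)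
      + x ^ 2 * ∫ s : Plane, (‖∂_{(EuclideanSpace.single k 1 : Plane)} h s‖ ^ 2
        + ‖r (s k) • h s‖ ^ 2) := by
  refine (quadratic_heisenberg h k x).trans ?_
  have hD := integrable_norm_sq volume (∂_{(EuclideanSpace.single k 1 : Plane)} h)
  have hrk : (fun s : Plane => r (s k)).HasTemperateGrowth := hr.comp (hasTemperateGrowth_coord k)
  have hQ := integrable_norm_sq volume (SchwartzMap.smulLeftCLM F (fun s : Plane => r (s k)) h)
  simp only [SchwartzMap.smulLeftCLM_apply_apply hrk] at hQ
  gcongr ?_ + ?_ * ?_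
  · rfl
  · exact integral_mono hD (hD.add hQ) fun s => le_add_of_nonneg_right (sq_nonneg _)

end Heisenberg

/-! ### Summation over the real components -/

section Components

/-- The `m`-th real component, as a continuous linear map. -/
noncomputable def componentCLM (m : Fin 4) : ℍ[ℝ] →L[ℝ] ℝ :=
  LinearMap.toContinuousLinearMap
    { toFun := component m
      map_add' := fun p q => by fin_cases m <;> simp [component]
      map_smul' := fun c p => by fin_cases m <;> simp [component] }

theorem sum_component_sq (q : ℍ[ℝ]) : ∑ m : Fin 4, component m q ^ 2 = ‖q‖ ^ 2 := by
  rw [norm_sq_eq, Fin.sum_univ_four]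
  rfl

/-- The `m`-th real component of a Schwartz function. -/
noncomputable def componentSchwartz (m : Fin 4) (h : 𝓢(Plane, ℍ[ℝ])) : 𝓢(Plane, ℝ) :=
  SchwartzMap.postcompCLM (𝕜 := ℝ) (componentCLM m) h

theorem componentSchwartz_apply (m : Fin 4) (h : 𝓢(Plane, ℍ[ℝ])) (s : Plane) :
    componentSchwartz m h s = component m (h s) := rfl

theorem lineDerivOp_componentSchwartz (m : Fin 4) (h : 𝓢(Plane, ℍ[ℝ])) (v s : Plane) :
    ∂_{v} (componentSchwartz m h) s = component m (∂_{v} h s) := by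
  have h1 := (componentCLM m).hasFDerivAt.comp s (h.hasFDerivAt s)
  rw [SchwartzMap.lineDerivOp_apply_eq_fderiv, SchwartzMap.lineDerivOp_apply_eq_fderiv]
  erw [h1.fderiv]
  rfl

/-- The modulus is defined through real components, so the identity for real signals applies to each
and the squares add up. -/
theorem integral_transformModulus_sq {lam mu : ℍ[ℝ]} (hlam : lam ^ 2 = -1) (hmu : mu ^ 2 = -1)
    (A : Fin 2 → Params) {k : Fin 2} (hb : (A k).b ≠ 0) (h : 𝓢(Plane, ℍ[ℝ])) :
    ∫ ξ : Plane, ((ξ k / (2 * Real.pi * (A k).b)) *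
        transformModulus (qolct lam mu A) h ξ) ^ 2
      = 1 / (4 * Real.pi ^ 2) * ∫ s : Plane,
        (‖∂_{(EuclideanSpace.single k 1 : Plane)} h s‖ ^ 2
          + ‖chirpPhaseDeriv (A k) (s k) • h s‖ ^ 2) := by
  have hK := fun m : Fin 4 =>
    integrable_and_integral_norm_qolct_sq hlam hmu A (componentSchwartz m h) hb
  have hexp : ∀ ξ : Plane, ((ξ k / (2 * Real.pi * (A k).b)) *
      transformModulus (qolct lam mu A) h ξ) ^ 2
      = ∑ m : Fin 4, (ξ k / (2 * Real.pi * (A k).b)) ^ 2 *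
        ‖qolct lam mu A (fun s => (componentSchwartz m h s : ℍ[ℝ])) ξ‖ ^ 2 := by
    intro ξ
    rw [mul_pow, transformModulus, Real.sq_sqrt (Finset.sum_nonneg fun m _ => sq_nonneg _),
      Finset.mul_sum]
    rfl
  simp only [hexp]
  rw [integral_finsetSum _ fun m _ => (hK m).1]
  simp only [fun m => (hK m).2]
  have hr : (fun s : Plane => chirpPhaseDeriv (A k) (s k)).HasTemperateGrowth :=
    (hasTemperateGrowth_chirpPhaseDeriv (A k)).comp (hasTemperateGrowth_coord k)
  rw [← Finset.mul_sum, ← integral_finsetSum _ fun m _ => integrable_sq_add_sq volume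
    (componentSchwartz m h) hr (EuclideanSpace.single k 1)]
  congr 2
  funext s
  simp only [lineDerivOp_componentSchwartz, componentSchwartz_apply, mul_pow,
    Finset.sum_add_distrib, ← Finset.mul_sum, sum_component_sq, norm_smul, Real.norm_eq_abs, sq_abs]

end Components

theorem l2Norm_pow_four (f : Plane → ℍ[ℝ]) : l2Norm f ^ 4 = (∫ t, ‖f t‖ ^ 2) ^ 2 := by
  rw [l2Norm, show 4 = 2 * 2 from rfl, pow_mul, Real.sq_sqrt (integral_nonneg fun t => sq_nonneg _)]

end QOLCT

/-! ### The uncertainty inequality -/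

open QOLCT LineDeriv in
theorem mainTheorem3 (lam mu : ℍ[ℝ]) (hlam : lam ^ 2 = -1) (hmu : mu ^ 2 = -1)
    (A : Fin 2 → QOLCT.Params) (f g : 𝓢(QOLCT.Plane, ℍ[ℝ])) (k : Fin 2) (hb : (A k).b ≠ 0) :
    (∫ t : QOLCT.Plane, ∫ s : QOLCT.Plane, ‖(s k) • QOLCT.crossSignal f g t s‖ ^ 2) *
      (∫ t : QOLCT.Plane, ∫ ξ : QOLCT.Plane,
        ((ξ k / (2 * Real.pi * (A k).b)) * QOLCT.wvdModulus lam mu A f g t ξ) ^ 2) ≥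
      1 / (16 * Real.pi ^ 2) * QOLCT.l2Norm f ^ 4 * QOLCT.l2Norm g ^ 4 := by
  set v : Plane := EuclideanSpace.single k 1 with hv
  have hW : ∀ t, ∫ ξ : Plane, ((ξ k / (2 * Real.pi * (A k).b)) * wvdModulus lam mu A f g t ξ) ^ 2
      = 1 / (4 * Real.pi ^ 2) * ∫ s : Plane, (‖∂_{v} (crossSchwartz f g t) s‖ ^ 2
          + ‖chirpPhaseDeriv (A k) (s k) • crossSignal f g t s‖ ^ 2) := by
    intro t
    have h := integral_transformModulus_sq hlam hmu A hb (crossSchwartz f g t)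
    have hc : (crossSchwartz f g t : Plane → ℍ[ℝ]) = crossSignal f g t :=
      funext (crossSchwartz_apply f g t)
    simp only [hc] at h
    exact h
  simp only [hW]
  rw [integral_const_mul]
  obtain ⟨hNi, hNv⟩ := integrable_and_integral_norm_crossSignal_sq f g
  -- Joint integrability in `(t, s)` makes the inner integrals integrable in `t`, which is needed to
  -- split the integrated quadratic.
  have hPi := (memLp_coord_smul_crossSignal k f g).integrable_norm_pow (p := 2) (by norm_num)
  have hDi := (memLp_lineDerivOp_crossSchwartz v f g).integrable_norm_pow (p := 2) (by norm_num)
  have hQi := (memLp_chirpPhaseDeriv_smul_crossSignal (A k) k f g).integrable_norm_pow (p := 2)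
    (by norm_num)
  have hN : Integrable fun t : Plane => ∫ s : Plane, ‖crossSignal f g t s‖ ^ 2 :=
    hNi.integral_prod_left
  have hP : Integrable fun t : Plane => ∫ s : Plane, ‖s k • crossSignal f g t s‖ ^ 2 :=
    hPi.integral_prod_left
  have hE : Integrable fun t : Plane => ∫ s : Plane, (‖∂_{v} (crossSchwartz f g t) s‖ ^ 2
      + ‖chirpPhaseDeriv (A k) (s k) • crossSignal f g t s‖ ^ 2) := (hDi.add hQi).integral_prod_left
  rw [integral_prod _ hNi] at hNv
  have hquad : ∀ x : ℝ, 0 ≤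
      (∫ t : Plane, ∫ s : Plane, (‖∂_{v} (crossSchwartz f g t) s‖ ^ 2
          + ‖chirpPhaseDeriv (A k) (s k) • crossSignal f g t s‖ ^ 2)) * (x * x)
      + (-∫ t : Plane, ∫ s : Plane, ‖crossSignal f g t s‖ ^ 2) * x
      + ∫ t : Plane, ∫ s : Plane, ‖s k • crossSignal f g t s‖ ^ 2 := by
    intro x
    have h : 0 ≤ ∫ t : Plane, ((∫ s : Plane, ‖s k • crossSignal f g t s‖ ^ 2)
        - x * (∫ s : Plane, ‖crossSignal f g t s‖ ^ 2)
        + x ^ 2 * ∫ s : Plane, (‖∂_{v} (crossSchwartz f g t) s‖ ^ 2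
          + ‖chirpPhaseDeriv (A k) (s k) • crossSignal f g t s‖ ^ 2)) :=
      integral_nonneg fun t => by
        have h := quadratic_heisenberg_add (crossSchwartz f g t) k
          (hasTemperateGrowth_chirpPhaseDeriv (A k)) x
        simp only [crossSchwartz_apply] at h
        exact h
    have hPN : Integrable fun t : Plane => (∫ s : Plane, ‖s k • crossSignal f g t s‖ ^ 2)
        - x * ∫ s : Plane, ‖crossSignal f g t s‖ ^ 2 := hP.sub (hN.const_mul x)
    rw [integral_add hPN (hE.const_mul _), integral_sub hP (hN.const_mul x),
      integral_const_mul, integral_const_mul] at h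
    linarith
  -- The discriminant gives `N² ≤ 4 E P` with `N = |f|² |g|²`; the Plancherel factor `1/(4π²)` on
  -- `E` turns this into the constant `1/(16π²)`.
  have hdisc := discrim_le_zero hquad
  rw [discrim, hNv] at hdisc
  rw [l2Norm_pow_four, l2Norm_pow_four, ge_iff_le]
  have hpi := Real.pi_pos
  set P := ∫ t : Plane, ∫ s : Plane, ‖s k • crossSignal f g t s‖ ^ 2
  set E := ∫ t : Plane, ∫ s : Plane, (‖∂_{v} (crossSchwartz f g t) s‖ ^ 2
          + ‖chirpPhaseDeriv (A k) (s k) • crossSignal f g t s‖ ^ 2)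
  calc 1 / (16 * Real.pi ^ 2) * (∫ t, ‖f t‖ ^ 2) ^ 2 * (∫ t, ‖g t‖ ^ 2) ^ 2
      = 1 / (16 * Real.pi ^ 2) * (-((∫ t, ‖f t‖ ^ 2) * ∫ t, ‖g t‖ ^ 2)) ^ 2 := by ring
    _ ≤ 1 / (16 * Real.pi ^ 2) * (4 * E * P) := by
        gcongr
        linarith
    _ = P * (1 / (4 * Real.pi ^ 2) * E) := by
        field_simp
        norm_num
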